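/- Let $\mathbb H^m=\{x\in\mathbb R^m : |x|<1\}$ be the Poincaré disk model of hyperbolic space, with metric $\left(\frac{2}{1-|x|^2}\right)^2 I_m$ and distance $d(p,q)=\operatorname{arcosh}\left(1+\frac{2|p-q|^2}{(1-|p|^2)(1-|q|^2)}\right)$. Let $n\ge 1$, $q_1,\dots,q_n\in\mathbb H^m$ and $p_0\in\mathbb H^m$, let $$f(p)=\frac1n\sum_{i=1}^n \frac12\, d(p,q_i)^2,\qquad D=\max\Big\{d(0,p_0),\ \max_{1\le i\le n} d(0,q_i)\Big\},$$ and let $p_{t+1}=\exp_{p_t}\!\left(-\eta\,(\operatorname{grad} f)_{p_t}\right)$, $t=0,1,2,\dots$, be the iterates of geodesic (Riemannian) gradient descent with constant step size $\eta=\frac{1}{2D+1}$, where $\operatorname{grad}$ and $\exp$ are the Riemannian gradient and exponential map of $\mathbb H^m$. Then $f$ has a global minimizer on $\mathbb H^m$; every iterate satisfies $d(0,p_t)\le D$; and for every global minimizer $p_{opt}$ of $f$ and every $t\ge 0$, $$f(p_t)-f(p_{opt})\le (1-\varepsilon)^{t-2}D^3,\qquad \varepsilon=\min\left\{\frac{1}{D\coth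 D},\ \frac{1}{2D+1}\right\}$$ (if $D=0$, the right-hand side is read as $0$). -/

import Mathlib

noncomputable section

namespace PoincareBall

open scoped InnerProductSpace

/-- Coordinate space of the disk model. -/
abbrev Coord (m : ℕ) : Type := EuclideanSpace ℝ (Fin m)

/-- The underlying set of the Poincaré disk (ball) model of radius `1`. -/
abbrev Disk (m : ℕ) : Set (Coord m) := Metric.ball (0 : Coord m) 1

/-- The origin of the hyperbolic space. -/
def origin (m : ℕ) : Disk m := ⟨0, Metric.mem_ball_self one_pos⟩

/-- The hyperbolic metric at `p` is the Euclidean inner product multiplied by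
`metricFactor p = (2 / (1 - |p|²))²`. -/
def metricFactor {m : ℕ} (p : Coord m) : ℝ := (2 / (1 - ‖p‖ ^ 2)) ^ 2

/-- The hyperbolic distance on the Poincaré disk. -/
def hypDist {m : ℕ} (p q : Coord m) : ℝ :=
  Real.arcosh (1 + 2 * (‖p - q‖ ^ 2 / ((1 - ‖p‖ ^ 2) * (1 - ‖q‖ ^ 2))))

/-- The Riemannian gradient: inverse metric matrix applied to the vector of partial derivatives. -/
def hypGrad {m : ℕ} (f : Coord m → ℝ) (p : Coord m) : Coord m :=
  (metricFactor p)⁻¹ • gradient f p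

/-- The Christoffel symbols of the hyperbolic metric as a bilinear map: the `k`-th coordinate of
`christoffel p v w` is `∑ i j, Γ_{ij}^k(p) v^i w^j`, where
`Γ_{ij}^k(p) = 2 (p^i δ_{jk} + p^j δ_{ik} - p^k δ_{ij}) / (1 - |p|²)`. -/
def christoffel {m : ℕ} (p v w : Coord m) : Coord m :=
  (2 / (1 - ‖p‖ ^ 2)) • (⟪p, v⟫_ℝ • w + ⟪p, w⟫_ℝ • v - ⟪v, w⟫_ℝ • p)

/-- A geodesic of the disk model, defined for all times: a solution `γ'' = -Γ(γ', γ')` of the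
geodesic equation that stays in the disk. -/
structure IsGeodesic {m : ℕ} (γ : ℝ → Coord m) : Prop where
  mem : ∀ s, γ s ∈ Disk m
  diff : ∀ s, DifferentiableAt ℝ γ s
  eqn : ∀ s, HasDerivAt (deriv γ) (-christoffel (γ s) (deriv γ s) (deriv γ s)) s

theorem isGeodesic_of_hyperboloid {m : ℕ} (u₀ u₁ : Coord m) (w₀ w₁ k : ℝ) (hw : 0 < w₀)
    (h00 : w₀ ^ 2 - ⟪u₀, u₀⟫_ℝ = 1) (h01 : w₀ * w₁ = ⟪u₀, u₁⟫_ℝ)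
    (h11 : w₁ ^ 2 - ⟪u₁, u₁⟫_ℝ = -1) :
    IsGeodesic (fun s : ℝ => (1 + (Real.cosh (k * s) * w₀ + Real.sinh (k * s) * w₁))⁻¹ •
        (Real.cosh (k * s) • u₀ + Real.sinh (k * s) • u₁)) ∧
    deriv (fun s : ℝ => (1 + (Real.cosh (k * s) * w₀ + Real.sinh (k * s) * w₁))⁻¹ •
        (Real.cosh (k * s) • u₀ + Real.sinh (k * s) • u₁)) 0 =
      (k / (1 + w₀)) • u₁ - (k * w₁ / (1 + w₀) ^ 2) • u₀ := by
  have hcs : w₁ ^ 2 < w₀ ^ 2 := by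
    have h := real_inner_mul_inner_self_le u₀ u₁
    rw [← h01] at h
    have e0 : ⟪u₀, u₀⟫_ℝ = w₀ ^ 2 - 1 := by linarith
    have e1 : ⟪u₁, u₁⟫_ℝ = w₁ ^ 2 + 1 := by linarith
    rw [e0, e1] at h
    nlinarith
  have habs : |w₁| < w₀ := by
    have := sq_lt_sq.mp hcs
    rwa [abs_of_pos hw] at this
  have hpos : ∀ s : ℝ, 0 < 1 + (Real.cosh (k * s) * w₀ + Real.sinh (k * s) * w₁) := by
    intro s
    have h1 : |Real.sinh (k * s)| < Real.cosh (k * s) := by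
      have := Real.cosh_sq (k * s)
      have h2 : Real.sinh (k * s) ^ 2 < Real.cosh (k * s) ^ 2 := by linarith
      have h3 := sq_lt_sq.mp h2
      rwa [abs_of_pos (Real.cosh_pos _)] at h3
    have h4 : |Real.sinh (k * s) * w₁| ≤ Real.cosh (k * s) * w₀ := by
      rw [abs_mul]
      exact mul_le_mul h1.le habs.le (abs_nonneg _) (Real.cosh_pos _).le
    have h5 := neg_abs_le (Real.sinh (k * s) * w₁)
    linarith
  have hc : ∀ s : ℝ, HasDerivAt (fun s => Real.cosh (k * s)) (k * Real.sinh (k * s)) s := by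
    intro s
    have := (((hasDerivAt_id s).const_mul k).cosh)
    simpa [mul_comm] using this
  have hs : ∀ s : ℝ, HasDerivAt (fun s => Real.sinh (k * s)) (k * Real.cosh (k * s)) s := by
    intro s
    have := (((hasDerivAt_id s).const_mul k).sinh)
    simpa [mul_comm] using this
  set w : ℝ → ℝ := fun s => 1 + (Real.cosh (k * s) * w₀ + Real.sinh (k * s) * w₁) with hwdef
  set w' : ℝ → ℝ := fun s => k * (Real.sinh (k * s) * w₀ + Real.cosh (k * s) * w₁) with hwdef'
  have hdw : ∀ s, HasDerivAt w (w' s) s := by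
    intro s
    have := (((hc s).mul_const w₀).add ((hs s).mul_const w₁)).const_add 1
    refine this.congr_deriv ?_
    simp only [hwdef']; ring
  have hdw' : ∀ s, HasDerivAt w' (k ^ 2 * (w s - 1)) s := by
    intro s
    have := (((hs s).mul_const w₀).add ((hc s).mul_const w₁)).const_mul k
    refine this.congr_deriv ?_
    simp only [hwdef]; ring
  set A : ℝ → ℝ := fun s => (w s)⁻¹ with hA
  have hdA : ∀ s, HasDerivAt A (-(w' s) / (w s) ^ 2) s := fun s => (hdw s).inv (hpos s).ne'
  set a : ℝ → ℝ := fun s => (w s)⁻¹ * Real.cosh (k * s) with ha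
  set b : ℝ → ℝ := fun s => (w s)⁻¹ * Real.sinh (k * s) with hb
  set a' : ℝ → ℝ := fun s =>
    -(w' s) / (w s) ^ 2 * Real.cosh (k * s) + (w s)⁻¹ * (k * Real.sinh (k * s)) with ha'
  set b' : ℝ → ℝ := fun s =>
    -(w' s) / (w s) ^ 2 * Real.sinh (k * s) + (w s)⁻¹ * (k * Real.cosh (k * s)) with hb'
  have hda : ∀ s, HasDerivAt a (a' s) s := fun s => (hdA s).mul (hc s)
  have hdb : ∀ s, HasDerivAt b (b' s) s := fun s => (hdA s).mul (hs s)
  have hdB : ∀ s, HasDerivAt (fun s => -(w' s) / (w s) ^ 2)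
      ((-(k ^ 2 * (w s - 1)) * (w s) ^ 2 - -(w' s) * (2 * w s * w' s)) / ((w s) ^ 2) ^ 2) s := by
    intro s
    have h := (hdw' s).neg.div ((hdw s).pow 2) (pow_ne_zero 2 (hpos s).ne')
    refine h.congr_deriv ?_
    simp
  have hda' : ∀ s, HasDerivAt a'
      ((-(k ^ 2 * (w s - 1)) * (w s) ^ 2 - -(w' s) * (2 * w s * w' s)) / ((w s) ^ 2) ^ 2
          * Real.cosh (k * s) + -(w' s) / (w s) ^ 2 * (k * Real.sinh (k * s))
        + (-(w' s) / (w s) ^ 2 * (k * Real.sinh (k * s))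
          + (w s)⁻¹ * (k * (k * Real.cosh (k * s))))) s := fun s =>
    ((hdB s).mul (hc s)).add ((hdA s).mul ((hs s).const_mul k))
  have hdb' : ∀ s, HasDerivAt b'
      ((-(k ^ 2 * (w s - 1)) * (w s) ^ 2 - -(w' s) * (2 * w s * w' s)) / ((w s) ^ 2) ^ 2
          * Real.sinh (k * s) + -(w' s) / (w s) ^ 2 * (k * Real.cosh (k * s))
        + (-(w' s) / (w s) ^ 2 * (k * Real.cosh (k * s))
          + (w s)⁻¹ * (k * (k * Real.sinh (k * s))))) s := fun s =>
    ((hdB s).mul (hs s)).add ((hdA s).mul ((hc s).const_mul k))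
  have hγ : (fun s : ℝ => (w s)⁻¹ • (Real.cosh (k * s) • u₀ + Real.sinh (k * s) • u₁)) =
      fun s => a s • u₀ + b s • u₁ := by
    funext s
    simp only [ha, hb, smul_add, smul_smul]
  have hdγ : ∀ s, HasDerivAt (fun s => a s • u₀ + b s • u₁) (a' s • u₀ + b' s • u₁) s :=
    fun s => ((hda s).smul_const u₀).add ((hdb s).smul_const u₁)
  have hderiv : deriv (fun s => a s • u₀ + b s • u₁) = fun s => a' s • u₀ + b' s • u₁ :=
    funext fun s => (hdγ s).deriv
  have g00 : ⟪u₀, u₀⟫_ℝ = w₀ ^ 2 - 1 := by linarith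
  have g11 : ⟪u₁, u₁⟫_ℝ = w₁ ^ 2 + 1 := by linarith
  have g10 : ⟪u₁, u₀⟫_ℝ = w₀ * w₁ := by rw [real_inner_comm, h01]
  have inn : ∀ x y x' y' : ℝ, ⟪x • u₀ + y • u₁, x' • u₀ + y' • u₁⟫_ℝ =
      x * x' * (w₀ ^ 2 - 1) + (x * y' + y * x') * (w₀ * w₁) + y * y' * (w₁ ^ 2 + 1) := by
    intro x y x' y'
    simp only [inner_add_left, inner_add_right, real_inner_smul_left, real_inner_smul_right,
      g00, g11, g10, ← h01]
    ring
  have hnorm : ∀ s, 1 - ‖a s • u₀ + b s • u₁‖ ^ 2 = 2 / w s := by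
    intro s
    rw [← real_inner_self_eq_norm_sq, inn]
    have h1 := (hpos s).ne'
    have h2 := Real.cosh_sq (k * s)
    simp only [ha, hb]
    have h3 : w s ≠ 0 := h1
    field_simp
    simp only [hwdef]
    linear_combination h2
  have hv1 : ∀ s, ⟪a s • u₀ + b s • u₁, a' s • u₀ + b' s • u₁⟫_ℝ = w' s / (w s) ^ 2 := by
    intro s
    rw [inn]
    have h2 := Real.cosh_sq (k * s)
    have h3 : w s ≠ 0 := (hpos s).ne'
    simp only [ha, hb, ha', hb']
    field_simp
    simp only [hwdef, hwdef']
    linear_combination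
      (k * (Real.sinh (k * s) * w₀ + Real.cosh (k * s) * w₁)) * h2
  have hv2 : ∀ s, ⟪a' s • u₀ + b' s • u₁, a' s • u₀ + b' s • u₁⟫_ℝ = k ^ 2 / (w s) ^ 2 := by
    intro s
    rw [inn]
    have h2 := Real.cosh_sq (k * s)
    have h3 : w s ≠ 0 := (hpos s).ne'
    simp only [ha', hb']
    field_simp
    simp only [hwdef, hwdef']
    linear_combination k ^ 2 * ((1 + (Real.cosh (k * s) * w₀ + Real.sinh (k * s) * w₁)) ^ 2 -
      (Real.sinh (k * s) * w₀ + Real.cosh (k * s) * w₁) ^ 2) * h2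
  rw [hγ]
  refine ⟨⟨?_, fun s => (hdγ s).differentiableAt, ?_⟩, ?_⟩
  · intro s
    rw [mem_ball_zero_iff]
    have h1 := hnorm s
    have h2 : 0 < 2 / w s := div_pos two_pos (hpos s)
    have h3 : ‖a s • u₀ + b s • u₁‖ ^ 2 < 1 := by linarith
    nlinarith [norm_nonneg (a s • u₀ + b s • u₁)]
  · intro s
    rw [hderiv]
    refine (((hda' s).smul_const u₀).add ((hdb' s).smul_const u₁)).congr_deriv ?_
    simp only [christoffel, hnorm, hv1, hv2]
    have h3 : w s ≠ 0 := (hpos s).ne'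
    simp only [ha, hb, ha', hb']
    match_scalars
    · field_simp
      ring
    · field_simp
      ring
  · rw [hderiv]
    simp only [ha', hb', hwdef, hwdef', mul_zero, Real.cosh_zero, Real.sinh_zero,
      one_mul, zero_mul, add_zero, zero_add, mul_one]
    have h3 : 1 + w₀ ≠ 0 := by positivity
    match_scalars
    · field_simp
    · field_simp

theorem exists_isGeodesic {m : ℕ} (p : Disk m) (v : Coord m) :
    ∃ γ : ℝ → Coord m, IsGeodesic γ ∧ γ 0 = p ∧ deriv γ 0 = v := by
  obtain ⟨p, hp⟩ := p
  have hp1 : ‖p‖ < 1 := mem_ball_zero_iff.mp hp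
  have ha : 0 < 1 - ‖p‖ ^ 2 := by nlinarith [norm_nonneg p]
  by_cases hv : v = 0
  · refine ⟨fun _ => p, ⟨fun _ => hp, fun _ => differentiableAt_const _, fun s => ?_⟩, rfl, ?_⟩
    · have : deriv (fun _ : ℝ => p) = fun _ => 0 := by simp
      rw [this]
      simpa [christoffel] using hasDerivAt_const s (0 : Coord m)
    · simp [hv]
  · set a : ℝ := 1 - ‖p‖ ^ 2 with had
    set r : ℝ := ⟪p, v⟫_ℝ with hr
    set k : ℝ := 2 * ‖v‖ / a with hk
    have hvn : 0 < ‖v‖ := norm_pos_iff.mpr hv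
    have hk0 : 0 < k := by positivity
    have hpp : ⟪p, p⟫_ℝ = 1 - a := by rw [real_inner_self_eq_norm_sq]; ring
    have hvv : ⟪v, v⟫_ℝ = (k * a / 2) ^ 2 := by
      rw [real_inner_self_eq_norm_sq, hk]; field_simp
    have hvp : ⟪v, p⟫_ℝ = r := by rw [real_inner_comm]
    have h := isGeodesic_of_hyperboloid ((2 / a) • p)
      ((2 / (a * k)) • v + (4 * r / (a ^ 2 * k)) • p) ((2 - a) / a) (4 * r / (a ^ 2 * k)) k
      (div_pos (by nlinarith [norm_nonneg p]) ha)
      (by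
        simp only [real_inner_smul_left, real_inner_smul_right, hpp]
        field_simp
        ring)
      (by
        simp only [inner_add_right, real_inner_smul_left, real_inner_smul_right, hpp, ← hr]
        field_simp
        ring)
      (by
        simp only [inner_add_left, inner_add_right, real_inner_smul_left, real_inner_smul_right,
          hpp, hvv, hvp, ← hr]
        field_simp
        ring)
    refine ⟨_, h.1, ?_, h.2.trans ?_⟩
    · simp only [mul_zero, Real.cosh_zero, Real.sinh_zero, one_mul, zero_mul, add_zero,
        zero_smul, smul_smul]
      have : (1 + (2 - a) / a)⁻¹ * (2 / a) = 1 := by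
        field_simp
        ring
      rw [this, one_smul]
    · have e1 : 1 + (2 - a) / a = 2 / a := by field_simp; ring
      rw [e1]
      match_scalars
      · field_simp
      · field_simp
        ring

/-- The exponential map `exp_p(v) = γ(1)`, where `γ` is the geodesic with `γ(0) = p` and
`γ'(0) = v`. -/
def expMap {m : ℕ} (p : Disk m) (v : Coord m) : Disk m :=
  ⟨(exists_isGeodesic p v).choose 1, (exists_isGeodesic p v).choose_spec.1.mem 1⟩

/-- The geodesic update (Riemannian gradient descent) with constant step size `η`. -/
def geodesicDescent {m : ℕ} (f : Coord m → ℝ) (η : ℝ) (p₀ : Disk m) : ℕ → Disk m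
  | 0 => p₀
  | t + 1 => expMap (geodesicDescent f η p₀ t) (-(η • hypGrad f (geodesicDescent f η p₀ t)))

/-- The barycenter objective: the mean of the halved squared hyperbolic distances to
`q₁, …, qₙ`. -/
def barycenterObj {m n : ℕ} (q : Fin n → Disk m) (x : Coord m) : ℝ :=
  (1 / (n : ℝ)) * ∑ i, (1 / 2) * hypDist x (q i) ^ 2

/-- A barycenter: a global minimizer of the barycenter objective over the hyperbolic space. -/
def IsBarycenter {m n : ℕ} (q : Fin n → Disk m) (p : Disk m) : Prop :=
  ∀ x : Disk m, barycenterObj q p ≤ barycenterObj q x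

/-- `D = max {d(0, p₀), maxᵢ d(0, qᵢ)}`. -/
def dataRadius {m n : ℕ} (p₀ : Disk m) (q : Fin n → Disk m) : ℝ :=
  max (hypDist (origin m : Coord m) p₀) (⨆ i, hypDist (origin m : Coord m) (q i))

/-- The hyperbolic cotangent. -/
def coth (x : ℝ) : ℝ := Real.cosh x / Real.sinh x

/-- `ε = min {1 / (D coth D), 1 / (2 D + 1)}`. -/
def rate (D : ℝ) : ℝ := min (1 / (D * coth D)) (1 / (2 * D + 1))

end PoincareBall

end

noncomputable section

namespace PoincareBall

open scoped InnerProductSpace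

/-! ### Inequalities for hyperbolic functions of one variable -/

section Scalar

open Real Set

/-! On the hyperboloid, cosh d is minus the Minkowski product, and a geodesic is the combination of
its initial point and unit velocity with coefficients cosh and sinh. Hence a gradient step changes
every cosh d(p, y) by an explicit formula (`coshDist_expMap`, `inner_coshGrad`), and all estimates
reduce to scalar ones.

The analytic input is that d² is a concave function of cosh d (`sq_le_tangent`). Its tangents bound
f after a step from above: f drops by at least (η/2)|grad f|² provided η(1 + d(p, qᵢ)) ≤ 1 for all i
(`barycenterObj_gradientStep_le`). Jensen's inequality for the same function compares hyperbolic
with Euclidean triangles (`law_of_cosines_comparison`); this is 1-strong convexity of f and gives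
f(p) - f(y) ≤ |grad f|²/2 (`barycenterObj_sub_le`). Together, f(p) - f(y) contracts by 1 - η per
step, for every y.

The step condition persists because the ball of radius D about the origin is invariant
(`hypDist_zero_gradientStep_le`), so that d(p, qᵢ) ≤ 2D throughout. For D > 0, x coth x ≤ 1 + x
shows ε = η (`rate_eq`), and the initial gap 2D² is absorbed into (1 - ε)⁻²D³. The contraction also
yields existence of a minimizer. -/

/-- The function `c / sinh c`, extended by `1` at `c = 0`. -/
def invSinhc (c : ℝ) : ℝ := if c = 0 then 1 else c / sinh c

theorem invSinhc_zero : invSinhc 0 = 1 := if_pos rfl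

theorem invSinhc_nonneg {c : ℝ} (hc : 0 ≤ c) : 0 ≤ invSinhc c := by
  unfold invSinhc
  split_ifs
  · exact zero_le_one
  · exact div_nonneg hc (sinh_nonneg_iff.2 hc)

theorem invSinhc_mul_sinh (c : ℝ) : invSinhc c * sinh c = c := by
  by_cases h : c = 0
  · simp [h]
  · have : sinh c ≠ 0 := by simpa using h
    rw [invSinhc, if_neg h]
    field_simp

theorem sinh_le_mul_cosh {x : ℝ} (hx : 0 ≤ x) : sinh x ≤ x * cosh x := by
  have hd : ∀ y : ℝ, HasDerivAt (fun x => x * cosh x - sinh x) (y * sinh y) y := fun y => by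
    refine (((hasDerivAt_id y).mul (hasDerivAt_cosh y)).sub (hasDerivAt_sinh y)).congr_deriv ?_
    simp
  have hm : MonotoneOn (fun x => x * cosh x - sinh x) (Ici (0 : ℝ)) := by
    refine monotoneOn_of_deriv_nonneg (convex_Ici 0)
      (fun y _ => (hd y).continuousAt.continuousWithinAt)
      (fun y _ => (hd y).differentiableAt.differentiableWithinAt) fun y hy => ?_
    rw [interior_Ici, mem_Ioi] at hy
    rw [(hd y).deriv]
    exact mul_nonneg hy.le (sinh_nonneg_iff.2 hy.le)
  have := hm self_mem_Ici hx hx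
  simpa using this

/-- This is the monotonicity of sinh x / x, cleared of denominators so that it includes zero. -/
theorem mul_sinh_le_mul_sinh {a c : ℝ} (ha : 0 ≤ a) (hac : a ≤ c) :
    c * sinh a ≤ a * sinh c := by
  have hd : ∀ y : ℝ, HasDerivAt (fun x => a * sinh x - x * sinh a) (a * cosh y - sinh a) y :=
    fun y => by
      refine (((hasDerivAt_sinh y).const_mul a).sub
        ((hasDerivAt_id y).mul_const (sinh a))).congr_deriv ?_
      simp
  have hm : MonotoneOn (fun x => a * sinh x - x * sinh a) (Ici a) := by
    refine monotoneOn_of_deriv_nonneg (convex_Ici a)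
      (fun y _ => (hd y).continuousAt.continuousWithinAt)
      (fun y _ => (hd y).differentiableAt.differentiableWithinAt) fun y hy => ?_
    rw [interior_Ici, mem_Ioi] at hy
    rw [(hd y).deriv]
    have h1 := sinh_le_mul_cosh ha
    have h2 : cosh a ≤ cosh y := by
      rw [cosh_le_cosh, abs_of_nonneg ha, abs_of_pos (ha.trans_lt hy)]
      exact hy.le
    nlinarith
  have := hm self_mem_Ici hac hac
  simp only [sub_self] at this
  linarith

theorem one_add_sq_div_two_le_cosh (x : ℝ) : 1 + x ^ 2 / 2 ≤ cosh x := by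
  have h1 : (x / 2) ^ 2 ≤ sinh (x / 2) ^ 2 := by
    wlog hx : 0 ≤ x generalizing x
    · have := this (-x) (by linarith)
      simpa [neg_div] using this
    · exact pow_le_pow_left₀ (by positivity) (self_le_sinh_iff.2 (by positivity)) 2
  have h2 := cosh_two_mul (x / 2)
  have h3 := cosh_sq (x / 2)
  rw [mul_div_cancel₀ x two_ne_zero] at h2
  linarith

/-- The square of the inverse hyperbolic cosine lies below its tangents. -/
theorem sq_le_tangent (a : ℝ) {c : ℝ} (hc : 0 ≤ c) :
    a ^ 2 ≤ c ^ 2 + 2 * invSinhc c * (cosh a - cosh c) := by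
  wlog ha : 0 ≤ a generalizing a
  · have := this (-a) (by linarith)
    simpa using this
  rcases hc.eq_or_lt with rfl | hc
  · have := one_add_sq_div_two_le_cosh a
    rw [invSinhc_zero, cosh_zero]
    linarith
  have hs : 0 < sinh c := sinh_pos_iff.2 hc
  -- Up to the factor `sinh c` and an additive constant, this function is the gap between tangent
  -- and square. For y > 0 its derivative has the sign of sinh y / y - sinh c / c, so the gap is
  -- smallest at `c`.
  have hd : ∀ y : ℝ, HasDerivAt (fun x => 2 * c * cosh x - x ^ 2 * sinh c)
      (2 * (c * sinh y - y * sinh c)) y := fun y => by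
    refine (((hasDerivAt_cosh y).const_mul (2 * c)).sub
      ((hasDerivAt_pow 2 y).mul_const (sinh c))).congr_deriv ?_
    simp
    ring
  have key : 2 * c * cosh c - c ^ 2 * sinh c ≤ 2 * c * cosh a - a ^ 2 * sinh c := by
    rcases le_total a c with hac | hac
    · have hm : AntitoneOn (fun x => 2 * c * cosh x - x ^ 2 * sinh c) (Icc 0 c) := by
        refine antitoneOn_of_deriv_nonpos (convex_Icc 0 c)
          (fun y _ => (hd y).continuousAt.continuousWithinAt)
          (fun y _ => (hd y).differentiableAt.differentiableWithinAt) fun y hy => ?_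
        rw [interior_Icc] at hy
        rw [(hd y).deriv]
        linarith [mul_sinh_le_mul_sinh hy.1.le hy.2.le]
      exact hm ⟨ha, hac⟩ ⟨hc.le, le_rfl⟩ hac
    · have hm : MonotoneOn (fun x => 2 * c * cosh x - x ^ 2 * sinh c) (Ici c) := by
        refine monotoneOn_of_deriv_nonneg (convex_Ici c)
          (fun y _ => (hd y).continuousAt.continuousWithinAt)
          (fun y _ => (hd y).differentiableAt.differentiableWithinAt) fun y hy => ?_
        rw [interior_Ici, mem_Ioi] at hy
        rw [(hd y).deriv]
        linarith [mul_sinh_le_mul_sinh hc.le hy.le]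
      exact hm self_mem_Ici hac hac
  have e : invSinhc c = c / sinh c := if_neg hc.ne'
  rw [e]
  have : c ^ 2 + 2 * (c / sinh c) * (cosh a - cosh c) - a ^ 2 =
      ((2 * c * cosh a - a ^ 2 * sinh c) - (2 * c * cosh c - c ^ 2 * sinh c)) / sinh c := by
    field_simp
    ring
  have h2 : 0 ≤ ((2 * c * cosh a - a ^ 2 * sinh c) - (2 * c * cosh c - c ^ 2 * sinh c)) / sinh c :=
    div_nonneg (by linarith) hs.le
  linarith

/-- Comparison of the hyperbolic and the Euclidean law of cosines. -/
theorem law_of_cosines_comparison {a b c : ℝ} (ha : 0 ≤ a) (hb : 0 ≤ b) (hc : 0 ≤ c)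
    (h : |cosh a - cosh b * cosh c| ≤ sinh b * sinh c) :
    b ^ 2 + c ^ 2 + 2 * (invSinhc b * invSinhc c) * (cosh a - cosh b * cosh c) ≤ a ^ 2 := by
  set P := invSinhc b * invSinhc c with hP
  have hPs : P * (sinh b * sinh c) = b * c := by
    calc P * (sinh b * sinh c) = (invSinhc b * sinh b) * (invSinhc c * sinh c) := by
          rw [hP]; ring
      _ = b * c := by rw [invSinhc_mul_sinh, invSinhc_mul_sinh]
  rcases (mul_nonneg hb hc).eq_or_lt with h0 | h0
  · have hs : sinh b * sinh c = 0 := by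
      rcases mul_eq_zero.1 h0.symm with h | h <;> simp [h]
    rw [hs] at h
    have h1 : cosh a - cosh b * cosh c = 0 := abs_nonpos_iff.1 h
    rw [h1, mul_zero, add_zero]
    rcases mul_eq_zero.1 h0.symm with h | h
    · subst h
      rw [cosh_zero, one_mul, sub_eq_zero] at h1
      have := (cosh_le_cosh.1 h1.ge)
      rw [abs_of_nonneg ha, abs_of_nonneg hc] at this
      nlinarith
    · subst h
      rw [cosh_zero, mul_one, sub_eq_zero] at h1
      have := (cosh_le_cosh.1 h1.ge)
      rw [abs_of_nonneg ha, abs_of_nonneg hb] at this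
      nlinarith
  · have hb' : 0 < b := lt_of_le_of_ne hb fun h => by simp [← h] at h0
    have hc' : 0 < c := lt_of_le_of_ne hc fun h => by simp [← h] at h0
    have hs : 0 < sinh b * sinh c := mul_pos (sinh_pos_iff.2 hb') (sinh_pos_iff.2 hc')
    obtain ⟨y, hy⟩ : ∃ y, cosh a - cosh b * cosh c = sinh b * sinh c * y :=
      ⟨(cosh a - cosh b * cosh c) / (sinh b * sinh c), by field_simp⟩
    have hy1 : |y| ≤ 1 := by
      rw [hy, abs_mul, abs_of_pos hs] at h
      exact le_of_mul_le_mul_left (by linarith) hs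
    obtain ⟨hy2, hy3⟩ := abs_le.1 hy1
    -- `cosh a` is the mean of cosh (b + c) and cosh (b - c) with weights (1 ± y)/2. Averaging the
    -- two tangent bounds at `a` with these weights cancels the linear terms and leaves b² + c² +
    -- 2bcy ≤ a².
    have h1 := sq_le_tangent (b + c) ha
    have h2 := sq_le_tangent (b - c) ha
    rw [cosh_add] at h1
    rw [cosh_sub] at h2
    have e1 : cosh b * cosh c + sinh b * sinh c - cosh a = sinh b * sinh c * (1 - y) := by
      linarith
    have e2 : cosh b * cosh c - sinh b * sinh c - cosh a = -(sinh b * sinh c * (1 + y)) := by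
      linarith
    rw [e1] at h1
    rw [e2] at h2
    have h3 := mul_le_mul_of_nonneg_left h1 (by linarith : 0 ≤ (1 + y) / 2)
    have h4 := mul_le_mul_of_nonneg_left h2 (by linarith : 0 ≤ (1 - y) / 2)
    have e3 : P * (cosh a - cosh b * cosh c) = b * c * y := by
      rw [hy, ← mul_assoc, hPs]
    rw [mul_assoc, e3]
    nlinarith

theorem two_mul_cosh_sub_one_le {k : ℝ} (hk : 0 ≤ k) : 2 * (cosh k - 1) ≤ k * sinh k := by
  obtain ⟨h, rfl⟩ : ∃ h, k = 2 * h := ⟨k / 2, by ring⟩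
  have h1 := sinh_le_mul_cosh (by linarith : 0 ≤ h)
  have h2 := sinh_nonneg_iff.2 (by linarith : 0 ≤ h)
  rw [cosh_two_mul, sinh_two_mul, cosh_sq]
  nlinarith

theorem sq_div_two_le_mul_sinh_sub_cosh {k : ℝ} (hk : 0 ≤ k) :
    k ^ 2 / 2 ≤ k * sinh k - (cosh k - 1) := by
  linarith [two_mul_cosh_sub_one_le hk, one_add_sq_div_two_le_cosh k]

/-- The difference cosh c - sinh c is exp (-c) ≤ 1, and c ≤ sinh c. The resulting bound c coth c ≤ 1
+ c controls the smoothness of d²/2 and so dictates the step size. -/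
theorem mul_cosh_le {c : ℝ} (hc : 0 ≤ c) : c * cosh c ≤ (1 + c) * sinh c := by
  have h1 : c * exp (-c) ≤ c := by
    have : exp (-c) ≤ 1 := exp_le_one_iff.2 (by linarith)
    nlinarith
  have h2 := self_le_sinh_iff.2 hc
  rw [← cosh_sub_sinh] at h1
  linarith

theorem invSinhc_mul_cosh_le {c : ℝ} (hc : 0 ≤ c) : invSinhc c * cosh c ≤ 1 + c := by
  rcases hc.eq_or_lt with rfl | hc
  · simp [invSinhc_zero]
  · rw [invSinhc, if_neg hc.ne', div_mul_eq_mul_div, div_le_iff₀ (sinh_pos_iff.2 hc)]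
    exact mul_cosh_le hc.le

theorem sq_div_le_invSinhc_mul {c : ℝ} (hc : 0 ≤ c) :
    c ^ 2 / 2 ≤ (1 + c) * (invSinhc c * (cosh c - 1)) := by
  rcases hc.eq_or_lt with rfl | hc
  · simp
  · have hs := sinh_pos_iff.2 hc
    -- In terms of h = c/2 this is h cosh h ≤ (1 + 2h) sinh h, weaker than `mul_cosh_le`.
    have key : c * sinh c ≤ 2 * (1 + c) * (cosh c - 1) := by
      obtain ⟨h, rfl⟩ : ∃ h, c = 2 * h := ⟨c / 2, by ring⟩
      have hh : 0 < h := by linarith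
      have h1 := mul_cosh_le hh.le
      have h2 := sinh_pos_iff.2 hh
      rw [cosh_two_mul, sinh_two_mul, cosh_sq]
      nlinarith [mul_le_mul_of_nonneg_left h1 h2.le, mul_pos hh (mul_pos h2 h2)]
    rw [invSinhc, if_neg hc.ne']
    have : (1 + c) * (c / sinh c * (cosh c - 1)) = c * ((1 + c) * (cosh c - 1)) / sinh c := by
      ring
    rw [this, le_div_iff₀ hs]
    nlinarith

end Scalar

/-! ### The hyperboloid model, and gradients of the distance -/

section Hyperboloid

variable {m : ℕ}

/-- The time coordinate of the point of the hyperboloid over `p`. -/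
def height (p : Coord m) : ℝ := (1 + ‖p‖ ^ 2) / (1 - ‖p‖ ^ 2)

/-- The space coordinates of the point of the hyperboloid over `p`. -/
def spatial (p : Coord m) : Coord m := (2 / (1 - ‖p‖ ^ 2)) • p

/-- The Minkowski product of the points of the hyperboloid over `p` and `q`. -/
def coshDist (p q : Coord m) : ℝ := height p * height q - ⟪spatial p, spatial q⟫_ℝ

/-- The Euclidean gradient of `coshDist · q` at `p`. -/
def coshGrad (q p : Coord m) : Coord m :=
  (4 * (height q - ⟪p, spatial q⟫_ℝ) / (1 - ‖p‖ ^ 2) ^ 2) • p - (2 / (1 - ‖p‖ ^ 2)) • spatial q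

theorem one_sub_norm_sq_pos {p : Coord m} (hp : p ∈ Disk m) : 0 < 1 - ‖p‖ ^ 2 := by
  have := mem_ball_zero_iff.1 hp
  nlinarith [norm_nonneg p]

theorem zero_mem_disk : (0 : Coord m) ∈ Disk m := Metric.mem_ball_self one_pos

theorem coshDist_comm (p q : Coord m) : coshDist p q = coshDist q p := by
  rw [coshDist, coshDist, real_inner_comm, mul_comm]

theorem coshDist_zero (q : Coord m) : coshDist 0 q = height q := by
  simp [coshDist, height, spatial]

theorem coshDist_eq {p q : Coord m} (hp : p ∈ Disk m) (hq : q ∈ Disk m) :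
    coshDist p q = 1 + 2 * (‖p - q‖ ^ 2 / ((1 - ‖p‖ ^ 2) * (1 - ‖q‖ ^ 2))) := by
  have h1 := one_sub_norm_sq_pos hp
  have h2 := one_sub_norm_sq_pos hq
  rw [norm_sub_sq_real]
  simp only [coshDist, height, spatial, real_inner_smul_left, real_inner_smul_right]
  field_simp
  ring

theorem one_le_coshDist {p q : Coord m} (hp : p ∈ Disk m) (hq : q ∈ Disk m) :
    1 ≤ coshDist p q := by
  have h1 := one_sub_norm_sq_pos hp
  have h2 := one_sub_norm_sq_pos hq
  rw [coshDist_eq hp hq]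
  have : 0 ≤ ‖p - q‖ ^ 2 / ((1 - ‖p‖ ^ 2) * (1 - ‖q‖ ^ 2)) := by positivity
  linarith

theorem hypDist_eq {p q : Coord m} (hp : p ∈ Disk m) (hq : q ∈ Disk m) :
    hypDist p q = Real.arcosh (coshDist p q) := by
  rw [hypDist, coshDist_eq hp hq]

theorem hypDist_nonneg {p q : Coord m} (hp : p ∈ Disk m) (hq : q ∈ Disk m) :
    0 ≤ hypDist p q := by
  rw [hypDist_eq hp hq]
  exact Real.arcosh_nonneg (one_le_coshDist hp hq)

theorem cosh_hypDist {p q : Coord m} (hp : p ∈ Disk m) (hq : q ∈ Disk m) :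
    Real.cosh (hypDist p q) = coshDist p q := by
  rw [hypDist_eq hp hq]
  exact Real.cosh_arcosh (one_le_coshDist hp hq)

theorem coshDist_self {p : Coord m} (hp : p ∈ Disk m) : coshDist p p = 1 := by
  simp [coshDist_eq hp hp]

theorem hypDist_self (p : Coord m) : hypDist p p = 0 := by
  simp [hypDist]

/-- The gradient of cosh d(·, q) corresponds, up to sign, to the tangential part at p of the lift of
q; the identity is the Minkowski product of two such projections. It serves as the hyperbolic law of
cosines at p. -/
theorem inner_coshGrad {p : Coord m} (hp : p ∈ Disk m) (q y : Coord m) :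
    (1 - ‖p‖ ^ 2) ^ 2 / 4 * ⟪coshGrad q p, coshGrad y p⟫_ℝ =
      coshDist p q * coshDist p y - coshDist q y := by
  have h1 := one_sub_norm_sq_pos hp
  have h2 : ⟪p, p⟫_ℝ = ‖p‖ ^ 2 := real_inner_self_eq_norm_sq p
  have h3 : ⟪spatial q, p⟫_ℝ = ⟪p, spatial q⟫_ℝ := real_inner_comm _ _
  have e1 : spatial p = (2 / (1 - ‖p‖ ^ 2)) • p := rfl
  simp only [coshGrad, coshDist, e1, inner_sub_left, inner_sub_right, real_inner_smul_left,
    real_inner_smul_right, h2, h3]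
  generalize spatial q = Q
  generalize spatial y = Y
  rw [show height p = (1 + ‖p‖ ^ 2) / (1 - ‖p‖ ^ 2) from rfl]
  field_simp
  ring

theorem norm_coshGrad {p q : Coord m} (hp : p ∈ Disk m) (hq : q ∈ Disk m) :
    (1 - ‖p‖ ^ 2) / 2 * ‖coshGrad q p‖ = Real.sinh (hypDist p q) := by
  have h1 := one_sub_norm_sq_pos hp
  have h := inner_coshGrad hp q q
  rw [real_inner_self_eq_norm_sq, coshDist_self hq, ← cosh_hypDist hp hq] at h
  have h2 := Real.cosh_sq (hypDist p q)
  have h3 := Real.sinh_nonneg_iff.2 (hypDist_nonneg hp hq)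
  refine (pow_left_inj₀ (by positivity) h3 two_ne_zero).1 ?_
  rw [mul_pow, div_pow]
  nlinarith

/-- Cauchy–Schwarz in the law of cosines bounds cosh d(q, y) by the cosh of the sum. -/
theorem hypDist_le_add {p q y : Coord m} (hp : p ∈ Disk m) (hq : q ∈ Disk m) (hy : y ∈ Disk m) :
    hypDist q y ≤ hypDist p q + hypDist p y := by
  have h := inner_coshGrad hp q y
  have h1 := one_sub_norm_sq_pos hp
  have h2 := (abs_le.1 (abs_real_inner_le_norm (coshGrad q p) (coshGrad y p))).1
  have h3 := mul_le_mul_of_nonneg_left h2 (by positivity : 0 ≤ (1 - ‖p‖ ^ 2) ^ 2 / 4)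
  have h4 : (1 - ‖p‖ ^ 2) ^ 2 / 4 * -(‖coshGrad q p‖ * ‖coshGrad y p‖) =
      -(Real.sinh (hypDist p q) * Real.sinh (hypDist p y)) := by
    rw [← norm_coshGrad hp hq, ← norm_coshGrad hp hy]
    ring
  rw [h4, h, ← cosh_hypDist hp hq, ← cosh_hypDist hp hy, ← cosh_hypDist hq hy] at h3
  have h5 : Real.cosh (hypDist q y) ≤ Real.cosh (hypDist p q + hypDist p y) := by
    rw [Real.cosh_add]
    linarith
  rw [Real.cosh_le_cosh, abs_of_nonneg (hypDist_nonneg hq hy),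
    abs_of_nonneg (add_nonneg (hypDist_nonneg hp hq) (hypDist_nonneg hp hy))] at h5
  exact h5

theorem hasGradientAt_coshDist {p : Coord m} (hp : p ∈ Disk m) (q : Coord m) :
    HasGradientAt (fun x => coshDist x q) (coshGrad q p) p := by
  have h1 := one_sub_norm_sq_pos hp
  have hn : HasFDerivAt (fun x : Coord m => 1 - ‖x‖ ^ 2) (-(2 • innerSL ℝ p)) p :=
    (hasStrictFDerivAt_norm_sq p).hasFDerivAt.const_sub 1
  have hi := (hasDerivAt_inv h1.ne').comp_hasFDerivAt p hn
  have hl : HasFDerivAt (fun x : Coord m => 2 * height q - 2 * ⟪spatial q, x⟫_ℝ)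
      (-((2 : ℝ) • innerSL ℝ (spatial q))) p :=
    (((innerSL ℝ (spatial q)).hasFDerivAt).const_mul 2).const_sub _
  have h := (hl.mul hi).sub_const (height q)
  have hU : (fun x => coshDist x q) =ᶠ[nhds p] fun x =>
      (2 * height q - 2 * ⟪spatial q, x⟫_ℝ) * (1 - ‖x‖ ^ 2)⁻¹ - height q := by
    filter_upwards [Metric.isOpen_ball.mem_nhds hp] with x hx
    have hx1 := one_sub_norm_sq_pos hx
    rw [coshDist, show spatial x = (2 / (1 - ‖x‖ ^ 2)) • x from rfl, real_inner_smul_left,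
      real_inner_comm, show height x = (1 + ‖x‖ ^ 2) / (1 - ‖x‖ ^ 2) from rfl]
    field_simp
    ring
  rw [hasGradientAt_iff_hasFDerivAt]
  refine (h.congr_of_eventuallyEq hU).congr_fderiv ?_
  ext w
  simp [coshGrad, real_inner_comm (spatial q) p]
  field_simp
  ring

theorem hasGradientAt_half_sq_hypDist {p q : Coord m} (hp : p ∈ Disk m) (hq : q ∈ Disk m) :
    HasGradientAt (fun x => 1 / 2 * hypDist x q ^ 2)
      (invSinhc (hypDist p q) • coshGrad q p) p := by
  have hg := hasGradientAt_coshDist hp q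
  by_cases h : p = q
  · subst h
    have h0 : coshGrad p p = 0 := by
      have h1 := norm_coshGrad hp hp
      have h2 := one_sub_norm_sq_pos hp
      rw [hypDist_self, Real.sinh_zero] at h1
      rcases mul_eq_zero.1 h1 with h3 | h3
      · linarith
      · exact norm_eq_zero.1 h3
    rw [h0] at hg
    rw [h0, smul_zero]
    rw [hasGradientAt_iff_hasFDerivAt] at hg ⊢
    rw [map_zero] at hg ⊢
    rw [hasFDerivAt_iff_isLittleO] at hg ⊢
    -- At p = q the chain rule fails, since arcosh is not differentiable at 1. Instead d²/2 ≤ cosh d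
    -- - 1, and the right side is o(|x - p|) because its gradient vanishes there.
    refine Asymptotics.IsBigO.trans_isLittleO (Asymptotics.IsBigO.of_bound 1 ?_) hg
    filter_upwards [Metric.isOpen_ball.mem_nhds hp] with x hx
    have h1 := sq_le_tangent (hypDist x p) le_rfl
    rw [invSinhc_zero, Real.cosh_zero, cosh_hypDist hx hp] at h1
    rw [hypDist_self, coshDist_self hp]
    simp only [zero_apply, sub_zero, one_mul, Real.norm_eq_abs, zero_pow two_ne_zero, mul_zero]
    rw [abs_of_nonneg (by positivity), abs_of_nonneg (by linarith [one_le_coshDist hx hp])]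
    linarith
  · have h1 : 1 < coshDist p q := by
      rw [coshDist_eq hp hq]
      have h1 := one_sub_norm_sq_pos hp
      have h2 := one_sub_norm_sq_pos hq
      have h3 : 0 < ‖p - q‖ := norm_pos_iff.2 (sub_ne_zero.2 h)
      have : 0 < ‖p - q‖ ^ 2 / ((1 - ‖p‖ ^ 2) * (1 - ‖q‖ ^ 2)) := by positivity
      linarith
    have hd := ((Real.hasDerivAt_arcosh h1).pow 2).const_mul (1 / 2)
    rw [hasGradientAt_iff_hasFDerivAt] at hg ⊢
    have hc := hd.comp_hasFDerivAt p hg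
    have hU : (fun x => 1 / 2 * hypDist x q ^ 2) =ᶠ[nhds p]
        (fun y => 1 / 2 * Real.arcosh y ^ 2) ∘ fun x => coshDist x q := by
      filter_upwards [Metric.isOpen_ball.mem_nhds hp] with x hx
      rw [Function.comp_apply, hypDist_eq hx hq]
    refine (hc.congr_of_eventuallyEq hU).congr_fderiv ?_
    have h2 : hypDist p q ≠ 0 := by
      rw [hypDist_eq hp hq]
      exact (Real.arcosh_pos h1).ne'
    rw [map_smulₛₗ]
    congr 1
    rw [invSinhc, if_neg h2, hypDist_eq hp hq, Real.sinh_arcosh h1.le]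
    simp
    ring

end Hyperboloid

/-! ### Uniqueness of geodesics and the exponential map -/

section Exponential

variable {m : ℕ}

/-- The geodesic flow of the disk model as a first-order vector field. -/
def geodesicField (z : Coord m × Coord m) : Coord m × Coord m := (z.2, -christoffel z.1 z.2 z.2)

theorem contDiffAt_geodesicField {z : Coord m × Coord m} (hz : z.1 ∈ Disk m) :
    ContDiffAt ℝ 1 geodesicField z := by
  have h1 := (one_sub_norm_sq_pos hz).ne'
  have h2 : ContDiffAt ℝ 1 (fun z : Coord m × Coord m => 2 / (1 - ‖z.1‖ ^ 2)) z :=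
    contDiffAt_const.div (contDiffAt_const.sub (contDiffAt_fst.norm_sq ℝ)) h1
  refine contDiffAt_snd.prodMk (ContDiffAt.neg (h2.smul ?_))
  have h3 := (contDiffAt_fst (𝕜 := ℝ) (n := 1) (p := z)).inner ℝ
    (contDiffAt_snd (𝕜 := ℝ) (n := 1) (p := z))
  have h4 := (contDiffAt_snd (𝕜 := ℝ) (n := 1) (p := z)).inner ℝ
    (contDiffAt_snd (𝕜 := ℝ) (n := 1) (p := z))
  exact ((h3.smul contDiffAt_snd).add (h3.smul contDiffAt_snd)).sub (h4.smul contDiffAt_fst)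

theorem IsGeodesic.hasDerivAt_lift {γ : ℝ → Coord m} (h : IsGeodesic γ) (s : ℝ) :
    HasDerivAt (fun s => (γ s, deriv γ s)) (geodesicField (γ s, deriv γ s)) s :=
  (h.diff s).hasDerivAt.prodMk (h.eqn s)

/-- A geodesic is determined at nonnegative times by its initial position and velocity. -/
theorem IsGeodesic.eq_of_initial {γ δ : ℝ → Coord m} (hγ : IsGeodesic γ) (hδ : IsGeodesic δ)
    (h0 : γ 0 = δ 0) (h1 : deriv γ 0 = deriv δ 0) {t : ℝ} (ht : 0 ≤ t) : γ t = δ t := by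
  set F : ℝ → Coord m × Coord m := fun s => (γ s, deriv γ s) with hF
  set G : ℝ → Coord m × Coord m := fun s => (δ s, deriv δ s) with hG
  have cF : Continuous F := continuous_iff_continuousAt.2 fun s => (hγ.hasDerivAt_lift s).continuousAt
  have cG : Continuous G := continuous_iff_continuousAt.2 fun s => (hδ.hasDerivAt_lift s).continuousAt
  -- The geodesic field is only locally Lipschitz; the two trajectories up to time `t` sweep out a
  -- compact set, on which one Lipschitz constant suffices.
  set S : Set (Coord m × Coord m) := F '' Set.Icc 0 t ∪ G '' Set.Icc 0 t with hS
  have hSc : IsCompact S := (isCompact_Icc.image cF).union (isCompact_Icc.image cG)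
  have hSd : ∀ z ∈ S, z.1 ∈ Disk m := by
    rintro z (⟨s, -, rfl⟩ | ⟨s, -, rfl⟩)
    exacts [hγ.mem s, hδ.mem s]
  obtain ⟨K, hK⟩ := LocallyLipschitzOn.exists_lipschitzOnWith_of_compact (f := geodesicField) hSc
    fun z hz => by
      obtain ⟨K, u, hu, hKu⟩ := (contDiffAt_geodesicField (hSd z hz)).exists_lipschitzOnWith
      exact ⟨K, u, mem_nhdsWithin_of_mem_nhds hu, hKu⟩
  have := ODE_solution_unique_of_mem_Icc_right (v := fun _ => geodesicField) (s := fun _ => S)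
    (K := K) (f := F) (g := G) (a := 0) (b := t) (fun _ _ => hK) cF.continuousOn
    (fun s _ => (hγ.hasDerivAt_lift s).hasDerivWithinAt)
    (fun s hs => Or.inl ⟨s, Set.Ico_subset_Icc_self hs, rfl⟩) cG.continuousOn
    (fun s _ => (hδ.hasDerivAt_lift s).hasDerivWithinAt)
    (fun s hs => Or.inr ⟨s, Set.Ico_subset_Icc_self hs, rfl⟩)
    (by simp [hF, hG, h0, h1])
  exact congrArg Prod.fst (this ⟨ht, le_rfl⟩)

/-- `expMap` evaluates a geodesic picked by choice; uniqueness allows it to be computed with any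
explicit one. -/
theorem expMap_eq_of_isGeodesic (p : Disk m) (v : Coord m) {γ : ℝ → Coord m} (hγ : IsGeodesic γ)
    (h0 : γ 0 = p) (h1 : deriv γ 0 = v) : (expMap p v : Coord m) = γ 1 := by
  have h := (exists_isGeodesic p v).choose_spec
  exact h.1.eq_of_initial hγ (h.2.1.trans h0.symm) (h.2.2.trans h1.symm) zero_le_one

theorem expMap_zero (p : Disk m) : expMap p 0 = p := by
  refine Subtype.ext (expMap_eq_of_isGeodesic p 0 (γ := fun _ => (p : Coord m))
    ⟨fun _ => p.2, fun _ => differentiableAt_const _, fun s => ?_⟩ rfl (by simp))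
  have : deriv (fun _ : ℝ => (p : Coord m)) = fun _ => 0 := by simp
  rw [this]
  simpa [christoffel] using hasDerivAt_const s (0 : Coord m)

theorem height_smul_of_hyperboloid {u : Coord m} {w : ℝ} (hw : 0 < w) (h : w ^ 2 - ⟪u, u⟫_ℝ = 1) :
    height ((1 + w)⁻¹ • u) = w := by
  have h1 : ‖(1 + w)⁻¹ • u‖ ^ 2 = (w - 1) / (1 + w) := by
    rw [real_inner_self_eq_norm_sq] at h
    rw [norm_smul, mul_pow, Real.norm_eq_abs, sq_abs, show ‖u‖ ^ 2 = (w - 1) * (1 + w) by linarith]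
    field_simp
  rw [height, h1]
  field_simp
  ring_nf

theorem spatial_smul_of_hyperboloid {u : Coord m} {w : ℝ} (hw : 0 < w)
    (h : w ^ 2 - ⟪u, u⟫_ℝ = 1) : spatial ((1 + w)⁻¹ • u) = u := by
  have h1 : ‖(1 + w)⁻¹ • u‖ ^ 2 = (w - 1) / (1 + w) := by
    rw [real_inner_self_eq_norm_sq] at h
    rw [norm_smul, mul_pow, Real.norm_eq_abs, sq_abs, show ‖u‖ ^ 2 = (w - 1) * (1 + w) by linarith]
    field_simp
  have h2 : 1 - (w - 1) / (1 + w) = 2 / (1 + w) := by field_simp; ring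
  rw [spatial, h1, h2, smul_smul]
  have h3 : 2 / (2 / (1 + w)) * (1 + w)⁻¹ = 1 := by field_simp
  rw [h3, one_smul]

/-- The hyperbolic law of cosines along the exponential map. -/
theorem coshDist_expMap (p : Disk m) (v q : Coord m) {k : ℝ}
    (hk : k = 2 * ‖v‖ / (1 - ‖(p : Coord m)‖ ^ 2)) :
    coshDist (expMap p v) q = Real.cosh k * coshDist p q +
      Real.sinh k / k * ⟪coshGrad q p, v⟫_ℝ := by
  by_cases hv : v = 0
  · simp [hk, hv, expMap_zero]
  obtain ⟨p, hp⟩ := p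
  simp only at hk ⊢
  have ha : 0 < 1 - ‖p‖ ^ 2 := one_sub_norm_sq_pos hp
  have hp1 : ‖p‖ < 1 := mem_ball_zero_iff.mp hp
  set a : ℝ := 1 - ‖p‖ ^ 2 with had
  set r : ℝ := ⟪p, v⟫_ℝ with hr
  have hvn : 0 < ‖v‖ := norm_pos_iff.mpr hv
  have hk0 : 0 < k := by rw [hk]; positivity
  have hpp : ⟪p, p⟫_ℝ = 1 - a := by rw [real_inner_self_eq_norm_sq]; ring
  have hvv : ⟪v, v⟫_ℝ = (k * a / 2) ^ 2 := by
    rw [real_inner_self_eq_norm_sq, hk]; field_simp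
  have hvp : ⟪v, p⟫_ℝ = r := by rw [real_inner_comm]
  have ha2 : 0 < 2 - a := by nlinarith [norm_nonneg p]
  -- (`u₀`, `w₀`) is the lift of `p` to the hyperboloid; (`u₁`, `w₁`) is the differential of the
  -- lift applied to `v`, divided by the hyperbolic length `k` of `v`.
  set u₀ : Coord m := (2 / a) • p with hu0
  set u₁ : Coord m := (2 / (a * k)) • v + (4 * r / (a ^ 2 * k)) • p with hu1
  set w₀ : ℝ := (2 - a) / a with hw0
  set w₁ : ℝ := 4 * r / (a ^ 2 * k) with hw1
  have h00 : w₀ ^ 2 - ⟪u₀, u₀⟫_ℝ = 1 := by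
    simp only [hu0, hw0, real_inner_smul_left, real_inner_smul_right, hpp]
    field_simp
    ring
  have h01 : w₀ * w₁ = ⟪u₀, u₁⟫_ℝ := by
    simp only [hu0, hu1, hw0, hw1, inner_add_right, real_inner_smul_left, real_inner_smul_right,
      hpp, ← hr]
    field_simp
    ring
  have h11 : w₁ ^ 2 - ⟪u₁, u₁⟫_ℝ = -1 := by
    simp only [hu1, hw1, inner_add_left, inner_add_right, real_inner_smul_left,
      real_inner_smul_right, hpp, hvv, hvp, ← hr]
    field_simp
    ring
  have hw0p : 0 < w₀ := div_pos ha2 ha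
  have h := isGeodesic_of_hyperboloid u₀ u₁ w₀ w₁ k hw0p h00 h01 h11
  have e1 : 1 + w₀ = 2 / a := by rw [hw0]; field_simp; ring
  have hexp := expMap_eq_of_isGeodesic ⟨p, hp⟩ v h.1
    (by
      simp only [mul_zero, Real.cosh_zero, Real.sinh_zero, one_mul, zero_mul, add_zero, zero_smul]
      have : (2 / a)⁻¹ * (2 / a) = 1 := by field_simp
      rw [e1, hu0, one_smul, smul_smul, this, one_smul])
    (h.2.trans (by
      rw [e1, hu0, hu1, hw1]
      match_scalars
      · field_simp
      · field_simp
        ring))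
  simp only [mul_one] at hexp
  set u : Coord m := Real.cosh k • u₀ + Real.sinh k • u₁ with hu
  set w : ℝ := Real.cosh k * w₀ + Real.sinh k * w₁ with hw
  have hwu : w ^ 2 - ⟪u, u⟫_ℝ = 1 := by
    have h10 : ⟪u₁, u₀⟫_ℝ = w₀ * w₁ := by rw [real_inner_comm, h01]
    have g00 : ⟪u₀, u₀⟫_ℝ = w₀ ^ 2 - 1 := by linarith
    have g11 : ⟪u₁, u₁⟫_ℝ = w₁ ^ 2 + 1 := by linarith
    have h2 := Real.cosh_sq k
    simp only [hu, hw, inner_add_left, inner_add_right, real_inner_smul_left,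
      real_inner_smul_right, g00, g11, h10, ← h01]
    linear_combination h2
  have hw1w : -w₀ ≤ w₁ := by
    have hr1 := (abs_le.1 (abs_real_inner_le_norm p v)).1
    have e : w₁ = 2 * r / (a * ‖v‖) := by
      rw [hw1, hk]; field_simp; ring
    rw [e, hw0, neg_le_iff_add_nonneg]
    have : 2 * r / (a * ‖v‖) + (2 - a) / a = (2 * r + (2 - a) * ‖v‖) / (a * ‖v‖) := by
      field_simp
    rw [this]
    refine div_nonneg ?_ (by positivity)
    nlinarith [sq_nonneg (1 - ‖p‖)]
  have hwp : 0 < w := by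
    have h1 : 0 < Real.sinh k := Real.sinh_pos_iff.2 hk0
    have h2 : 0 < Real.cosh k - Real.sinh k := by
      rw [Real.cosh_sub_sinh]; exact Real.exp_pos _
    rw [hw]
    nlinarith [mul_le_mul_of_nonneg_left hw1w h1.le, mul_pos h2 hw0p]
  have e2 : height p = (2 - a) / a := by rw [height, had]; congr 1; ring
  rw [hexp, coshDist, coshDist, height_smul_of_hyperboloid hwp hwu,
    spatial_smul_of_hyperboloid hwp hwu, e2, show spatial p = (2 / a) • p from rfl, coshGrad, ← had]
  have e3 : ⟪spatial q, v⟫_ℝ = ⟪v, spatial q⟫_ℝ := real_inner_comm _ _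
  simp only [hu, hw, hu0, hu1, hw0, hw1, inner_add_left, inner_sub_left, real_inner_smul_left,
    ← hr, e3]
  field_simp
  ring

end Exponential

/-! ### Arithmetic means -/

section Average

variable {n : ℕ}

/-- The arithmetic mean of a finite family of reals. -/
def avg (x : Fin n → ℝ) : ℝ := (1 / (n : ℝ)) * ∑ i, x i

theorem avg_add (x y : Fin n → ℝ) : avg (fun i => x i + y i) = avg x + avg y := by
  simp only [avg, Finset.sum_add_distrib, mul_add]

theorem avg_sub (x y : Fin n → ℝ) : avg (fun i => x i - y i) = avg x - avg y := by
  simp only [avg, Finset.sum_sub_distrib, mul_sub]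

theorem avg_const_mul (c : ℝ) (x : Fin n → ℝ) : avg (fun i => c * x i) = c * avg x := by
  simp only [avg, ← Finset.mul_sum]
  ring

theorem avg_const (hn : 1 ≤ n) (c : ℝ) : avg (fun _ : Fin n => c) = c := by
  have : (n : ℝ) ≠ 0 := by positivity
  simp only [avg, Finset.sum_const, Finset.card_univ, Fintype.card_fin, nsmul_eq_mul]
  field_simp

theorem avg_mono {x y : Fin n → ℝ} (h : ∀ i, x i ≤ y i) : avg x ≤ avg y :=
  mul_le_mul_of_nonneg_left (Finset.sum_le_sum fun i _ => h i) (by positivity)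

theorem avg_le (hn : 1 ≤ n) {x : Fin n → ℝ} {c : ℝ} (h : ∀ i, x i ≤ c) : avg x ≤ c :=
  (avg_mono h).trans (avg_const hn c).le

theorem avg_nonneg {x : Fin n → ℝ} (h : ∀ i, 0 ≤ x i) : 0 ≤ avg x :=
  mul_nonneg (by positivity) (Finset.sum_nonneg fun i _ => h i)

theorem sq_avg_le (hn : 1 ≤ n) (x : Fin n → ℝ) : avg x ^ 2 ≤ avg fun i => x i ^ 2 := by
  have h : 0 ≤ avg fun i => (x i ^ 2 - 2 * avg x * x i) + avg x ^ 2 :=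
    avg_nonneg fun i => by nlinarith [sq_nonneg (x i - avg x)]
  rw [avg_add, avg_sub, avg_const_mul, avg_const hn] at h
  linarith

end Average

/-! ### One gradient step on the barycenter objective -/

section Objective

variable {m n : ℕ} (q : Fin n → Disk m) (p : Disk m)

theorem barycenterObj_eq_avg (x : Coord m) :
    barycenterObj q x = avg fun i => 1 / 2 * hypDist x (q i) ^ 2 := rfl

/-- The Euclidean gradient of the barycenter objective. -/
def objGrad : Coord m :=
  (1 / (n : ℝ)) • ∑ i, invSinhc (hypDist (p : Coord m) (q i)) • coshGrad (q i : Coord m) p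

theorem gradient_barycenterObj : gradient (barycenterObj q) p = objGrad q p := by
  refine HasGradientAt.gradient ?_
  rw [hasGradientAt_iff_hasFDerivAt, objGrad, map_smulₛₗ, map_sum]
  exact (HasFDerivAt.fun_sum fun i _ =>
    (hasGradientAt_half_sq_hypDist p.2 (q i).2).hasFDerivAt).const_mul (1 / (n : ℝ))

/-- The Riemannian norm of the gradient of the barycenter objective. -/
def gradNorm : ℝ := (1 - ‖(p : Coord m)‖ ^ 2) / 2 * ‖objGrad q p‖

theorem gradNorm_nonneg : 0 ≤ gradNorm q p :=
  mul_nonneg (div_nonneg (one_sub_norm_sq_pos p.2).le zero_le_two) (norm_nonneg _)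

theorem hypGrad_barycenterObj :
    hypGrad (barycenterObj q) p = ((1 - ‖(p : Coord m)‖ ^ 2) ^ 2 / 4) • objGrad q p := by
  have := one_sub_norm_sq_pos p.2
  rw [hypGrad, gradient_barycenterObj, metricFactor, div_pow, inv_div]
  norm_num

theorem inner_objGrad (w : Coord m) :
    ⟪w, objGrad q p⟫_ℝ =
      avg fun i => invSinhc (hypDist (p : Coord m) (q i)) * ⟪w, coshGrad (q i : Coord m) p⟫_ℝ := by
  simp only [objGrad, avg, inner_smul_right, inner_sum]

theorem inner_coshGrad_objGrad (y : Coord m) :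
    (1 - ‖(p : Coord m)‖ ^ 2) ^ 2 / 4 * ⟪coshGrad y p, objGrad q p⟫_ℝ =
      avg fun i => invSinhc (hypDist (p : Coord m) (q i)) *
        (coshDist (p : Coord m) y * coshDist (p : Coord m) (q i) - coshDist (y : Coord m) (q i)) := by
  rw [inner_objGrad, ← avg_const_mul]
  congr 1
  funext i
  rw [← inner_coshGrad p.2]
  ring

theorem sq_gradNorm :
    gradNorm q p ^ 2 = avg fun i => invSinhc (hypDist (p : Coord m) (q i)) *
      ((1 - ‖(p : Coord m)‖ ^ 2) ^ 2 / 4 * ⟪coshGrad (q i : Coord m) p, objGrad q p⟫_ℝ) := by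
  have : gradNorm q p ^ 2 =
      (1 - ‖(p : Coord m)‖ ^ 2) ^ 2 / 4 * ⟪objGrad q p, objGrad q p⟫_ℝ := by
    rw [gradNorm, real_inner_self_eq_norm_sq]
    ring
  rw [this, inner_objGrad, ← avg_const_mul]
  congr 1
  funext i
  rw [real_inner_comm]
  ring

/-- The gradient is a mean of vectors whose Riemannian lengths are the distances to the data points.
-/
theorem gradNorm_le_avg : gradNorm q p ≤ avg fun i => hypDist (p : Coord m) (q i) := by
  have ha := one_sub_norm_sq_pos p.2
  have h1 : ‖objGrad q p‖ ≤
      avg fun i => invSinhc (hypDist (p : Coord m) (q i)) * ‖coshGrad (q i : Coord m) p‖ := by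
    rw [objGrad, norm_smul, Real.norm_of_nonneg (by positivity), avg]
    refine mul_le_mul_of_nonneg_left ((norm_sum_le _ _).trans_eq ?_) (by positivity)
    refine Finset.sum_congr rfl fun i _ => ?_
    rw [norm_smul, Real.norm_of_nonneg (invSinhc_nonneg (hypDist_nonneg p.2 (q i).2))]
  refine (mul_le_mul_of_nonneg_left h1 (by positivity)).trans_eq ?_
  rw [← avg_const_mul]
  congr 1
  funext i
  rw [mul_left_comm, norm_coshGrad p.2 (q i).2, invSinhc_mul_sinh]

/-- The geodesic gradient step. -/
theorem coshDist_gradientStep {η : ℝ} (hη : 0 ≤ η) (y : Coord m) :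
    coshDist (expMap p (-(η • hypGrad (barycenterObj q) p))) y =
      Real.cosh (η * gradNorm q p) * coshDist (p : Coord m) y -
        Real.sinh (η * gradNorm q p) / (η * gradNorm q p) *
          (η * ((1 - ‖(p : Coord m)‖ ^ 2) ^ 2 / 4 * ⟪coshGrad y p, objGrad q p⟫_ℝ)) := by
  have ha := one_sub_norm_sq_pos p.2
  rw [coshDist_expMap (k := η * gradNorm q p)]
  · rw [hypGrad_barycenterObj, inner_neg_right, inner_smul_right, inner_smul_right]
    ring
  · rw [hypGrad_barycenterObj, norm_neg, norm_smul, norm_smul, Real.norm_of_nonneg hη,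
      Real.norm_of_nonneg (by positivity), gradNorm]
    field_simp
    ring

/-- Sufficient decrease of the objective in one gradient step. -/
theorem barycenterObj_gradientStep_le (hn : 1 ≤ n) {η : ℝ} (hη : 0 < η)
    (h : ∀ i, η * (1 + hypDist (p : Coord m) (q i)) ≤ 1) :
    barycenterObj q (expMap p (-(η • hypGrad (barycenterObj q) p))) ≤
      barycenterObj q p - η / 2 * gradNorm q p ^ 2 := by
  set p' := expMap p (-(η • hypGrad (barycenterObj q) p)) with hp'
  set G := gradNorm q p with hG
  have hG0 : 0 ≤ G := gradNorm_nonneg q p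
  set k := η * G with hk
  have hk0 : 0 ≤ k := mul_nonneg hη.le hG0
  set S := Real.sinh k / k with hS
  set T : Fin n → ℝ := fun i => (1 - ‖(p : Coord m)‖ ^ 2) ^ 2 / 4 *
    ⟪coshGrad (q i : Coord m) p, objGrad q p⟫_ℝ with hT
  set φ : Fin n → ℝ := fun i => invSinhc (hypDist (p : Coord m) (q i)) with hφ
  -- Tangent bound at the old distance, with the new cosh given by the step formula.
  have h1 : ∀ i, 1 / 2 * hypDist (p' : Coord m) (q i) ^ 2 ≤ 1 / 2 * hypDist (p : Coord m) (q i) ^ 2 +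
      ((Real.cosh k - 1) * (φ i * Real.cosh (hypDist (p : Coord m) (q i))) - (S * η) * (φ i * T i)) := by
    intro i
    have h2 := sq_le_tangent (hypDist (p' : Coord m) (q i)) (hypDist_nonneg p.2 (q i).2)
    have h3 := coshDist_gradientStep q p hη.le (q i)
    rw [← cosh_hypDist p'.2 (q i).2, ← cosh_hypDist p.2 (q i).2] at h3
    rw [h3] at h2
    simp only [hφ, hT]
    linarith
  have h2 := avg_mono h1
  rw [avg_add, avg_sub, ← barycenterObj_eq_avg, ← barycenterObj_eq_avg,
    avg_const_mul, avg_const_mul, ← sq_gradNorm, ← hG] at h2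
  have h3 : η * (avg fun i => φ i * Real.cosh (hypDist (p : Coord m) (q i))) ≤ 1 := by
    rw [← avg_const_mul]
    exact avg_le hn fun i => (mul_le_mul_of_nonneg_left
      (invSinhc_mul_cosh_le (hypDist_nonneg p.2 (q i).2)) hη.le).trans (h i)
  have h4 : η * (S * η * G ^ 2) = k * Real.sinh k := by
    by_cases hk' : k = 0
    · have : G = 0 := by simpa [hk, hη.ne'] using hk'
      simp [hk', this]
    · rw [hS, show η * (Real.sinh k / k * η * G ^ 2) = Real.sinh k / k * (η * G) ^ 2 by ring,
        ← hk]
      field_simp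
  -- After multiplication by `η`, the change of f is at most (cosh k - 1) - k sinh k, hence at most
  -- -k²/2.
  have h5 := sq_div_two_le_mul_sinh_sub_cosh hk0
  have h6 := mul_le_mul_of_nonneg_left h3 (by linarith [Real.one_le_cosh k] : 0 ≤ Real.cosh k - 1)
  refine le_of_mul_le_mul_left ?_ hη
  have h7 := mul_le_mul_of_nonneg_left h2 hη.le
  have h8 : η * (η / 2 * G ^ 2) = k ^ 2 / 2 := by rw [hk]; ring
  nlinarith

/-- The Polyak–Łojasiewicz inequality for the barycenter objective. -/
theorem barycenterObj_sub_le (hn : 1 ≤ n) (y : Disk m) :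
    barycenterObj q p - barycenterObj q y ≤ gradNorm q p ^ 2 / 2 := by
  have ha := one_sub_norm_sq_pos p.2
  set b := hypDist (p : Coord m) y with hb
  have hb0 : 0 ≤ b := hypDist_nonneg p.2 y.2
  set G := gradNorm q p with hG
  set φ : Fin n → ℝ := fun i => invSinhc (hypDist (p : Coord m) (q i)) with hφ
  set T : Fin n → ℝ := fun i =>
    coshDist (p : Coord m) y * coshDist (p : Coord m) (q i) - coshDist (y : Coord m) (q i) with hT
  have h1 : ∀ i, b ^ 2 / 2 + 1 / 2 * hypDist (p : Coord m) (q i) ^ 2 - invSinhc b * (φ i * T i) ≤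
      1 / 2 * hypDist (y : Coord m) (q i) ^ 2 := by
    intro i
    have e1 := inner_coshGrad p.2 (y : Coord m) (q i)
    have h2 : |Real.cosh (hypDist (y : Coord m) (q i)) -
        Real.cosh b * Real.cosh (hypDist (p : Coord m) (q i))| ≤
        Real.sinh b * Real.sinh (hypDist (p : Coord m) (q i)) := by
      rw [cosh_hypDist y.2 (q i).2, cosh_hypDist p.2 (q i).2, cosh_hypDist p.2 y.2,
        ← abs_neg, neg_sub, ← e1, abs_mul, abs_of_nonneg (by positivity),
        ← norm_coshGrad p.2 y.2, ← norm_coshGrad p.2 (q i).2]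
      have := mul_le_mul_of_nonneg_left
        (abs_real_inner_le_norm (coshGrad (y : Coord m) p) (coshGrad (q i : Coord m) p))
        (by positivity : 0 ≤ (1 - ‖(p : Coord m)‖ ^ 2) ^ 2 / 4)
      linarith
    have h3 := law_of_cosines_comparison (hypDist_nonneg y.2 (q i).2) hb0
      (hypDist_nonneg p.2 (q i).2) h2
    rw [cosh_hypDist y.2 (q i).2, cosh_hypDist p.2 (q i).2, cosh_hypDist p.2 y.2] at h3
    simp only [hφ, hT]
    linarith
  have h2 := avg_mono h1
  rw [avg_sub, avg_add, avg_const hn, ← barycenterObj_eq_avg, ← barycenterObj_eq_avg,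
    avg_const_mul, ← inner_coshGrad_objGrad] at h2
  have h3 : (1 - ‖(p : Coord m)‖ ^ 2) ^ 2 / 4 * ⟪coshGrad (y : Coord m) p, objGrad q p⟫_ℝ ≤
      Real.sinh b * G := by
    rw [← norm_coshGrad p.2 y.2, hG, gradNorm]
    have := mul_le_mul_of_nonneg_left
      (real_inner_le_norm (coshGrad (y : Coord m) p) (objGrad q p))
      (by positivity : 0 ≤ (1 - ‖(p : Coord m)‖ ^ 2) ^ 2 / 4)
    linarith
  have h4 := mul_le_mul_of_nonneg_left h3 (invSinhc_nonneg hb0)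
  rw [← mul_assoc (invSinhc b) (Real.sinh b), invSinhc_mul_sinh] at h4
  -- Strong convexity has given f(p) - f(y) ≤ bG - b²/2, which is largest at b = G.
  nlinarith [sq_nonneg (b - G)]

/-- A gradient step does not leave a ball around the origin that contains the data. -/
theorem hypDist_zero_gradientStep_le (hn : 1 ≤ n) {η D : ℝ} (hη : 0 < η) (hD : 0 ≤ D)
    (h : ∀ i, η * (1 + hypDist (p : Coord m) (q i)) ≤ 1) (hp : hypDist (0 : Coord m) p ≤ D)
    (hq : ∀ i, hypDist (0 : Coord m) (q i) ≤ D) :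
    hypDist 0 (expMap p (-(η • hypGrad (barycenterObj q) p)) : Coord m) ≤ D := by
  set p' := expMap p (-(η • hypGrad (barycenterObj q) p)) with hp'
  set G := gradNorm q p with hG
  have hG0 : 0 ≤ G := gradNorm_nonneg q p
  set k := η * G with hk
  have hk0 : 0 ≤ k := mul_nonneg hη.le hG0
  set S := Real.sinh k / k with hS
  have hS0 : 0 ≤ S := div_nonneg (Real.sinh_nonneg_iff.2 hk0) hk0
  set c : Fin n → ℝ := fun i => hypDist (p : Coord m) (q i) with hc
  have hc0 : ∀ i, 0 ≤ c i := fun i => hypDist_nonneg p.2 (q i).2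
  have hle : ∀ y : Disk m, hypDist 0 (y : Coord m) ≤ D → coshDist (0 : Coord m) y ≤ Real.cosh D := by
    intro y hy
    rw [← cosh_hypDist zero_mem_disk y.2, Real.cosh_le_cosh,
      abs_of_nonneg (hypDist_nonneg zero_mem_disk y.2), abs_of_nonneg hD]
    exact hy
  set x := coshDist (0 : Coord m) p with hx
  set C := Real.cosh D with hC
  have hxC : x ≤ C := hle p hp
  set M₁ := avg fun i => invSinhc (c i) with hM₁
  set M₂ := avg fun i => invSinhc (c i) * Real.cosh (c i) with hM₂
  -- Only the bound by `C` on the cosh of the distance from the origin to each data point enters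
  -- here. The new value is then at most x(cosh k - SηM₂) + CSηM₁; with nonnegative coefficient and
  -- x ≤ C, it remains to show cosh k - 1 ≤ Sη(M₂ - M₁).
  have h1 : x * M₂ - C * M₁ ≤
      (1 - ‖(p : Coord m)‖ ^ 2) ^ 2 / 4 * ⟪coshGrad 0 (p : Coord m), objGrad q p⟫_ℝ := by
    rw [inner_coshGrad_objGrad, hM₁, hM₂, ← avg_const_mul, ← avg_const_mul, ← avg_sub]
    refine avg_mono fun i => ?_
    have h2 := mul_le_mul_of_nonneg_left (hle (q i) (hq i)) (invSinhc_nonneg (hc0 i))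
    rw [coshDist_comm (p : Coord m) 0, ← hx, ← cosh_hypDist p.2 (q i).2]
    simp only [hc] at h2 ⊢
    linarith
  have h3 : η * M₂ ≤ 1 := by
    rw [hM₂, ← avg_const_mul]
    exact avg_le hn fun i => (mul_le_mul_of_nonneg_left
      (invSinhc_mul_cosh_le (hc0 i)) hη.le).trans (h i)
  have h4 : S ≤ Real.cosh k :=
    div_le_of_le_mul₀ hk0 (Real.cosh_pos k).le (by linarith [sinh_le_mul_cosh hk0])
  have h5 : k ^ 2 / 2 ≤ η * (M₂ - M₁) := by
    have h6 : avg (fun i => η / 2 * c i ^ 2) ≤ M₂ - M₁ := by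
      rw [hM₁, hM₂, ← avg_sub]
      refine avg_mono fun i => ?_
      have h7 := mul_le_mul_of_nonneg_left (sq_div_le_invSinhc_mul (hc0 i)) hη.le
      have h8 : 0 ≤ invSinhc (c i) * (Real.cosh (c i) - 1) :=
        mul_nonneg (invSinhc_nonneg (hc0 i)) (by linarith [Real.one_le_cosh (c i)])
      have h9 := mul_le_mul_of_nonneg_right (h i) h8
      simp only [hc] at *
      linarith
    rw [avg_const_mul] at h6
    have h7 : G ^ 2 ≤ avg fun i => c i ^ 2 :=
      (pow_le_pow_left₀ hG0 (gradNorm_le_avg q p) 2).trans (sq_avg_le hn c)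
    have h8 := mul_le_mul_of_nonneg_left h6 hη.le
    have h9 := mul_le_mul_of_nonneg_left h7 (by positivity : 0 ≤ η ^ 2 / 2)
    rw [hk]
    linarith
  have h6 : Real.cosh k - 1 ≤ S * (η * (M₂ - M₁)) := by
    refine le_trans ?_ (mul_le_mul_of_nonneg_left h5 hS0)
    have h7 : S * (k ^ 2 / 2) = k * Real.sinh k / 2 := by
      by_cases hk' : k = 0
      · simp [hk']
      · rw [hS]; field_simp
    rw [h7]
    linarith [two_mul_cosh_sub_one_le hk0]
  have h7 : coshDist (p' : Coord m) 0 ≤ C := by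
    rw [hp', coshDist_gradientStep q p hη.le, coshDist_comm, ← hx, ← hG, ← hk, ← hS]
    have h8 := mul_le_mul_of_nonneg_left h1 (mul_nonneg hS0 hη.le)
    have h9 : 0 ≤ Real.cosh k - S * (η * M₂) := by nlinarith
    have h10 := mul_le_mul_of_nonneg_right hxC h9
    have h11 := mul_le_mul_of_nonneg_left h6 (Real.cosh_pos D).le
    rw [← hC] at h11
    nlinarith
  rw [coshDist_comm, ← cosh_hypDist zero_mem_disk p'.2, hC, Real.cosh_le_cosh,
    abs_of_nonneg (hypDist_nonneg zero_mem_disk p'.2), abs_of_nonneg hD] at h7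
  exact h7

end Objective

/-! ### Linear convergence and existence of the barycenter -/

section Convergence

variable {m n : ℕ}

/-- The Euclidean radius obtained is below 1, which supplies the compactness needed for a minimum.
-/
theorem norm_le_of_hypDist_zero_le {p : Coord m} (hp : p ∈ Disk m) {D : ℝ} (hD : 0 ≤ D)
    (h : hypDist 0 p ≤ D) : ‖p‖ ^ 2 ≤ 1 - 2 / (Real.cosh D + 1) := by
  have h1 := one_sub_norm_sq_pos hp
  have hC := Real.one_le_cosh D
  have h2 : Real.cosh (hypDist 0 p) ≤ Real.cosh D := by
    rw [Real.cosh_le_cosh, abs_of_nonneg (hypDist_nonneg zero_mem_disk hp), abs_of_nonneg hD]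
    exact h
  rw [cosh_hypDist zero_mem_disk hp, coshDist_zero, height, div_le_iff₀ h1] at h2
  have h3 : 2 / (Real.cosh D + 1) ≤ 1 - ‖p‖ ^ 2 := by
    rw [div_le_iff₀ (by positivity)]
    linarith
  linarith

theorem continuousOn_hypDist {q : Coord m} (hq : q ∈ Disk m) :
    ContinuousOn (fun x => hypDist x q) (Disk m) := by
  have h : ContinuousOn (fun x => Real.arcosh (coshDist x q)) (Disk m) :=
    Real.continuousOn_arcosh.comp
      (fun x hx => (hasGradientAt_coshDist hx q).hasFDerivAt.continuousAt.continuousWithinAt)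
      fun x hx => one_le_coshDist hx hq
  exact h.congr fun x hx => hypDist_eq hx hq

theorem continuousOn_barycenterObj (q : Fin n → Disk m) :
    ContinuousOn (barycenterObj q) (Disk m) :=
  continuousOn_const.mul (continuousOn_finsetSum _ fun i _ =>
    continuousOn_const.mul ((continuousOn_hypDist (q i).2).pow 2))

theorem barycenterObj_nonneg (q : Fin n → Disk m) (x : Coord m) : 0 ≤ barycenterObj q x :=
  avg_nonneg fun _ => by positivity

/-- The barycenter objective attains its minimum over every closed ball around the origin. -/
theorem exists_min_on_ball (q : Fin n → Disk m) {D : ℝ} (hD : 0 ≤ D) :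
    ∃ z : Disk m, ∀ x : Disk m, hypDist (0 : Coord m) x ≤ D →
      barycenterObj q z ≤ barycenterObj q x := by
  have hC := Real.one_le_cosh D
  set r : ℝ := 1 - 2 / (Real.cosh D + 1) with hr
  have hr1 : r < 1 := by
    have : 0 < 2 / (Real.cosh D + 1) := by positivity
    linarith
  have hr0 : 0 ≤ r := by
    have : 2 / (Real.cosh D + 1) ≤ 1 := by
      rw [div_le_one (by positivity)]
      linarith
    linarith
  have hsub : Metric.closedBall (0 : Coord m) √r ⊆ Disk m :=
    Metric.closedBall_subset_ball (by rwa [Real.sqrt_lt' one_pos, one_pow])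
  obtain ⟨z, hz, hmin⟩ := (isCompact_closedBall (0 : Coord m) √r).exists_isMinOn
    ⟨0, Metric.mem_closedBall_self (Real.sqrt_nonneg r)⟩
    ((continuousOn_barycenterObj q).mono hsub)
  refine ⟨⟨z, hsub hz⟩, fun x hx => hmin ?_⟩
  rw [mem_closedBall_zero_iff]
  exact Real.le_sqrt_of_sq_le (norm_le_of_hypDist_zero_le x.2 hD hx)

/-- Invariance of the ball and the step-size condition are proved together: within the ball the
triangle inequality gives d(p, qᵢ) ≤ 2D, and this makes the next step admissible. -/
theorem hypDist_zero_geodesicDescent_le (hn : 1 ≤ n) (q : Fin n → Disk m) (p₀ : Disk m) {D : ℝ}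
    (hD : 0 ≤ D) (hp₀ : hypDist (0 : Coord m) p₀ ≤ D) (hq : ∀ i, hypDist (0 : Coord m) (q i) ≤ D)
    (t : ℕ) :
    hypDist (0 : Coord m) (geodesicDescent (barycenterObj q) (1 / (2 * D + 1)) p₀ t) ≤ D ∧
      ∀ i, 1 / (2 * D + 1) *
        (1 + hypDist (geodesicDescent (barycenterObj q) (1 / (2 * D + 1)) p₀ t : Coord m)
          (q i)) ≤ 1 := by
  have step : ∀ p : Disk m, hypDist (0 : Coord m) p ≤ D →
      ∀ i, 1 / (2 * D + 1) * (1 + hypDist (p : Coord m) (q i)) ≤ 1 := by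
    intro p hp i
    have h1 := hypDist_le_add zero_mem_disk p.2 (q i).2
    rw [one_div_mul_eq_div, div_le_one (by positivity)]
    linarith [hq i]
  induction t with
  | zero => exact ⟨hp₀, step _ hp₀⟩
  | succ t ih =>
    have := hypDist_zero_gradientStep_le q _ hn (by positivity) hD ih.2 ih.1 hq
    exact ⟨this, step _ this⟩

/-- Linear convergence of the objective values, relative to any comparison point. -/
theorem barycenterObj_geodesicDescent_sub_le (hn : 1 ≤ n) (q : Fin n → Disk m) (p₀ : Disk m)
    {D : ℝ} (hD : 0 ≤ D) (hp₀ : hypDist (0 : Coord m) p₀ ≤ D)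
    (hq : ∀ i, hypDist (0 : Coord m) (q i) ≤ D) (y : Disk m) (t : ℕ) :
    barycenterObj q (geodesicDescent (barycenterObj q) (1 / (2 * D + 1)) p₀ t) -
        barycenterObj q y ≤
      (1 - 1 / (2 * D + 1)) ^ t * (barycenterObj q p₀ - barycenterObj q y) := by
  have hη : 0 < 1 / (2 * D + 1) := by positivity
  have hη1 : 0 ≤ 1 - 1 / (2 * D + 1) := by
    rw [sub_nonneg, div_le_one (by positivity)]
    linarith
  induction t with
  | zero => simp [geodesicDescent]
  | succ t ih =>
    set p := geodesicDescent (barycenterObj q) (1 / (2 * D + 1)) p₀ t with hp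
    have h1 := barycenterObj_gradientStep_le q p hn hη
      (hypDist_zero_geodesicDescent_le hn q p₀ hD hp₀ hq t).2
    have h2 := mul_le_mul_of_nonneg_left (barycenterObj_sub_le q p hn y) hη.le
    have h3 := mul_le_mul_of_nonneg_left ih hη1
    rw [geodesicDescent, ← hp, pow_succ']
    linarith

theorem barycenterObj_le_of_ball (hn : 1 ≤ n) (q : Fin n → Disk m) (p₀ : Disk m)
    {D : ℝ} (hp₀ : hypDist (0 : Coord m) p₀ ≤ D)
    (hq : ∀ i, hypDist (0 : Coord m) (q i) ≤ D) : barycenterObj q p₀ ≤ 2 * D ^ 2 :=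
  avg_le hn fun i => by
    have h1 := hypDist_le_add zero_mem_disk p₀.2 (q i).2
    have h2 := hypDist_nonneg p₀.2 (q i).2
    nlinarith [hq i]

/-- The barycenter exists. -/
theorem exists_isBarycenter (hn : 1 ≤ n) (q : Fin n → Disk m) {D : ℝ}
    (hD : 0 ≤ D) (hq : ∀ i, hypDist (0 : Coord m) (q i) ≤ D) : ∃ z : Disk m, IsBarycenter q z := by
  obtain ⟨z, hz⟩ := exists_min_on_ball q hD
  refine ⟨z, fun y => ?_⟩
  have h0 : hypDist (0 : Coord m) (origin m) ≤ D := (hypDist_self (0 : Coord m)).trans_le hD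
  -- A minimizer `z` over the ball is global: descent from the origin stays in the ball, so f(z) ≤
  -- f(p_t), while f(p_t) is at most f(y) plus a vanishing term for arbitrary `y`.
  have hlim : Filter.Tendsto (fun t : ℕ => (1 - 1 / (2 * D + 1)) ^ t *
      (barycenterObj q (origin m) - barycenterObj q y) + barycenterObj q y) Filter.atTop
      (nhds (0 * (barycenterObj q (origin m) - barycenterObj q y) + barycenterObj q y)) := by
    refine ((tendsto_pow_atTop_nhds_zero_of_lt_one ?_ ?_).mul_const _).add_const _
    · rw [sub_nonneg, div_le_one (by positivity)]
      linarith
    · have : 0 < 1 / (2 * D + 1) := by positivity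
      linarith
  rw [zero_mul, zero_add] at hlim
  refine ge_of_tendsto' hlim fun t => ?_
  have h1 := barycenterObj_geodesicDescent_sub_le hn q (origin m) hD h0 hq y t
  have h2 := hz _ (hypDist_zero_geodesicDescent_le hn q (origin m) hD h0 hq t).1
  linarith

theorem rate_eq {D : ℝ} (hD : 0 < D) : rate D = 1 / (2 * D + 1) := by
  have hs := Real.sinh_pos_iff.2 hD
  have hc := Real.cosh_pos D
  refine min_eq_right ?_
  refine one_div_le_one_div_of_le (by rw [coth]; positivity) ?_
  rw [coth, mul_div_assoc', div_le_iff₀ hs]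
  nlinarith [mul_cosh_le hD.le]

end Convergence

end PoincareBall

end

open PoincareBall in
theorem theorem2 {m n : ℕ} (hn : 1 ≤ n) (q : Fin n → Disk m) (p₀ : Disk m)
    (D : ℝ) (hD : D = dataRadius p₀ q)
    (p : ℕ → Disk m) (hp : p = geodesicDescent (barycenterObj q) (1 / (2 * D + 1)) p₀) :
    (∃ p_opt : Disk m, IsBarycenter q p_opt) ∧
    (∀ t : ℕ, hypDist (origin m : Coord m) (p t) ≤ D) ∧
    (∀ p_opt : Disk m, IsBarycenter q p_opt → ∀ t : ℕ,
      barycenterObj q (p t) - barycenterObj q p_opt ≤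
        (1 - rate D) ^ ((t : ℤ) - 2) * D ^ 3) := by
  have hp₀ : hypDist (0 : Coord m) p₀ ≤ D := hD ▸ le_max_left _ _
  have hq : ∀ i, hypDist (0 : Coord m) (q i) ≤ D := fun i =>
    hD ▸ (le_ciSup (f := fun i => hypDist (origin m : Coord m) (q i))
      (Set.finite_range _).bddAbove i).trans (le_max_right _ _)
  have hD0 : 0 ≤ D := (hypDist_nonneg zero_mem_disk p₀.2).trans hp₀
  refine ⟨exists_isBarycenter hn q hD0 hq, fun t => ?_, fun y _ t => ?_⟩
  · rw [hp]
    exact (hypDist_zero_geodesicDescent_le hn q p₀ hD0 hp₀ hq t).1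
  · have h1 := barycenterObj_geodesicDescent_sub_le hn q p₀ hD0 hp₀ hq y t
    rw [← hp] at h1
    have h2 := barycenterObj_le_of_ball hn q p₀ hp₀ hq
    have h3 := barycenterObj_nonneg q y
    have hη1 : 0 ≤ 1 - 1 / (2 * D + 1) := by
      rw [sub_nonneg, div_le_one (by positivity)]
      linarith
    have h4 := mul_le_mul_of_nonneg_left
      (by linarith : barycenterObj q p₀ - barycenterObj q y ≤ 2 * D ^ 2) (pow_nonneg hη1 t)
    refine (h1.trans h4).trans ?_
    rcases hD0.eq_or_lt with h0 | h0
    · simp [← h0]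
    · have e : 1 - 1 / (2 * D + 1) = 2 * D / (2 * D + 1) := by field_simp; ring
      have hpos : 0 < 1 - 1 / (2 * D + 1) := by rw [e]; positivity
      rw [rate_eq h0, zpow_sub₀ hpos.ne', zpow_natCast, div_mul_eq_mul_div, mul_div_assoc]
      refine mul_le_mul_of_nonneg_left ?_ (pow_nonneg hη1 t)
      rw [e, show (2 : ℤ) = ((2 : ℕ) : ℤ) from rfl, zpow_natCast]
      have e2 : D ^ 3 / (2 * D / (2 * D + 1)) ^ 2 = D * (2 * D + 1) ^ 2 / 4 := by
        field_simp
        ring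
      rw [e2]
      -- What remains is 2D² ≤ D(2D + 1)²/4, that is, 8D ≤ (2D + 1)², or (2D - 1)² ≥ 0.
      nlinarith [mul_nonneg h0.le (sq_nonneg (2 * D - 1))]
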